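/- For $u \in \mathbb{Z}[x]$ let $u^{(n)}$ denote the $n$-fold composition $u\circ\cdots\circ u$. For $r\in\mathbb{Z}$, $u$ is called nilpotent at $r$ of index $m$ if $m$ is the smallest positive integer $n$ with $u^{(n)}(r)=0$. Let $r$ be an integer with $r>3$, and let $u\in\mathbb{Z}[x]$ be nilpotent at $r$ of index exactly $r$. Then one of the following holds for some $p\in\mathbb{Z}[x]$: (i) $r=4$, and either $u(x)=(x-1)+(x-1)(x-2)(x-3)(x-4)\,p(x)$ or $u(x)=-2x^2+19x-39+p(x)(x-3)(x-4)(x-5)(x-6)$; (ii) $r\ge 5$, and $u(x)=(x-1)+(x-1)(x-2)\cdots(x-r)\,p(x)$. Let $r$ be an integer with $r<-3$, and let $u\in\mathbb{Z}[x]$ be nilpotent at $r$ of index exactly $|r|$. Then one of the following holds for some $p\in\mathbb{Z}[x]$: (i) $r=-4$, and either $u(x)=(x+1)+(x+1)(x+2)(x+3)(x+4)\,p(x)$ or $u(x)=2x^2+19x+39+p(x)(x+3)(x+4)(x+5)(x+6)$; (ii) $r\le -5$, and $u(x)=(x+1)+(x+1)(x+2)\cdots(x+|r|)\,p(x)$.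 -/

import Mathlib

open Polynomial

/-- The `n`-th iterate `u ∘ u ∘ ⋯ ∘ u` (`n` factors) of an integer polynomial, with
`polyIter u 0 = X`. -/
noncomputable def polyIter (u : ℤ[X]) (n : ℕ) : ℤ[X] :=
  u.comp^[n] X

/-- `u` is nilpotent at `r` of index `m`: `m` is the smallest positive integer `n` such that the
`n`-th iterate of `u` vanishes at `r` (so in particular there is such an `n`). -/
def IsNilpotentAtOfIndex (u : ℤ[X]) (r : ℤ) (m : ℕ) : Prop :=
  IsLeast {n : ℕ | 0 < n ∧ (polyIter u n).eval r = 0} m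

/-!
Let `r = N > 3` and let `a 0 = N, a 1, …, a N = 0` be the orbit. Its points are distinct, and
`a i - a j` divides `a (i + 1) - a (j + 1)`. In particular `ε = a 0 - a 1` divides everything in
sight, so the orbit can be rescaled to a sequence `b` starting with `0, 1` (`NormalizedOrbit`), whose
steps `b (i + 1) - b i` form a divisibility chain with first term `1`.

There are `N` steps, and the last one has absolute value at most `2 * N + 1`
(`NormalizedOrbit.abs_last_step_le`), while the steps grow exponentially as soon as two of them
differ: from then on no four consecutive steps are equal, so the absolute value at least doubles every
three steps (`NormalizedOrbit.two_mul_abs_step_le`). This leaves room only for an early first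
change of the steps. A change after at least four equal steps produces a step congruent to `1` modulo
a factorial, which is too large; an earlier change is excluded for `N ≥ 5` by a finite search
which shows that the fifth step exceeds `15` (`NormalizedOrbit.abs_fifth_step`). Hence for `N ≥ 5` all
steps are `1`, that is, `u x = x - 1` at `1, …, N`. For `N = 4` a similar search leaves one more
orbit, `4, 5, 6, 3, 0` (`NormalizedOrbit.four_cases`). In both cases `u` is determined modulo the
product of the linear factors at the nonzero points of the orbit.

Negative `r` reduces to positive `r` by replacing `u x` with `-u (-x)`.
-/

/-! ### Chains of small steps -/

set_option synthInstance.maxHeartbeats 200000 in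
set_option synthInstance.maxSize 1000 in
/-- The steps `1, x, y, z, w` of a normalized orbit of length at least five, all of absolute value at
most `15`: every sum of `g` consecutive steps divides the next such sum, and no such sum vanishes.
The congruence modulo `48` (third differences of an integer polynomial) excludes
`1, -2, -2, -2, -14`, the only chain with `x, y, z` not all `1` which passes the other tests. -/
theorem step_chain_of_abs_le_fifteen :
    ∀ x ∈ Finset.Icc (-15 : ℤ) 15, x ≠ 0 → 1 + x ≠ 0 →
    ∀ y ∈ Finset.Icc (-15 : ℤ) 15, y ≠ 0 → x ∣ y → x + y ≠ 0 → 1 + x + y ≠ 0 → 1 + x ∣ x + y →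
    ∀ z ∈ Finset.Icc (-15 : ℤ) 15, z ≠ 0 → y ∣ z → y + z ≠ 0 → x + y + z ≠ 0 →
      1 + x + y + z ≠ 0 → x + y ∣ y + z → 1 + x + y ∣ x + y + z →
    ∀ w ∈ Finset.Icc (-15 : ℤ) 15, w ≠ 0 → z ∣ w → y + z ∣ z + w → x + y + z ∣ y + z + w →
      1 + x + y + z ∣ x + y + z + w → (x = -2 → y = -2 → z = -2 → (48 : ℤ) ∣ w + 2) →
      x = 1 ∧ y = 1 ∧ z = 1 := by
  decide +kernel

/-- The steps `1, x, y, z` of a normalized orbit of length four, whose total divides `4` but is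
not `1`. The last alternative satisfies all pairwise divisibilities, but is not the orbit of an
integer polynomial. -/
theorem step_chain_of_abs_le_nine :
    ∀ x ∈ Finset.Icc (-9 : ℤ) 9, x ≠ 0 → 1 + x ≠ 0 →
    ∀ y ∈ Finset.Icc (-9 : ℤ) 9, y ≠ 0 → x ∣ y → x + y ≠ 0 → 1 + x + y ≠ 0 → 1 + x ∣ x + y →
    ∀ z ∈ Finset.Icc (-9 : ℤ) 9, z ≠ 0 → y ∣ z → y + z ≠ 0 → x + y + z ≠ 0 → x + y ∣ y + z → 1 + x + y ∣ x + y + z →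
      1 + x + y + z ≠ 1 → 1 + x + y + z ∣ 4 →
      (x = 1 ∧ y = 1 ∧ z = 1) ∨ (x = 1 ∧ y = -3 ∧ z = -3) ∨ (x = 1 ∧ y = 1 ∧ z = -5) := by
  decide +kernel

/-! ### Divisibility along orbits of integer polynomials -/

theorem prod_X_sub_C_dvd_of_eval_eq_zero (f : ℤ[X]) (s : Finset ℤ) (h : ∀ x ∈ s, f.eval x = 0) :
    ∏ i ∈ s, (X - C i) ∣ f := by
  rcases eq_or_ne f 0 with rfl | hf
  · exact dvd_zero _
  · refine (Multiset.prod_X_sub_C_dvd_iff_le_roots hf s.val).2 ?_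
    refine (Multiset.le_iff_subset s.nodup).2 fun x hx => ?_
    exact (mem_roots hf).2 (h x hx)

/-- If `k + 1` consecutive points of an orbit form an arithmetic progression with difference `E`,
then `u` agrees with `X + E` at the first `k` of them, so `u - (X + E)` is divisible by the product of
the corresponding linear factors; at the last point this product is `k! * E ^ k`. -/
theorem factorial_mul_pow_dvd_of_arith_run (u : ℤ[X]) (a : ℕ → ℤ)
    (ha : ∀ i, a (i + 1) = u.eval (a i)) (p k : ℕ) (E : ℤ)
    (hE : E ≠ 0) (hrun : ∀ i ≤ k, a (p + i) = a p + i * E) :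
    (k.factorial : ℤ) * E ^ k ∣ a (p + k + 1) - a (p + k) - E := by
  have hinj : Set.InjOn (fun i : ℕ => a p + i * E) (Finset.range k) := by
    intro i _ j _ hij
    simpa [hE] using hij
  have hdvd : ∏ x ∈ (Finset.range k).image (fun i : ℕ => a p + i * E), (X - C x) ∣
      u - (X + C E) := by
    refine prod_X_sub_C_dvd_of_eval_eq_zero _ _ fun x hx => ?_
    obtain ⟨i, hi, rfl⟩ := Finset.mem_image.1 hx
    have hi' : i < k := Finset.mem_range.1 hi
    have h1 := ha (p + i)
    rw [show p + i + 1 = p + (i + 1) by ring, hrun i hi'.le, hrun (i + 1) hi'] at h1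
    simp only [eval_sub, eval_add, eval_X, eval_C, ← h1]
    push_cast
    ring
  rw [Finset.prod_image hinj] at hdvd
  have h2 := _root_.map_dvd (evalRingHom (a (p + k))) hdvd
  simp only [coe_evalRingHom, eval_prod, eval_sub, eval_add, eval_X, eval_C, ← ha] at h2
  have h3 : ∏ i ∈ Finset.range k, (a (p + k) - (a p + i * E)) = (k.factorial : ℤ) * E ^ k := by
    rw [← Finset.prod_range_add_one_eq_factorial, ← Finset.prod_range_reflect]
    push_cast
    rw [← Finset.prod_range_reflect]
    have h4 := Finset.prod_mul_pow_card (s := Finset.range k) (f := fun j : ℕ => (j : ℤ) + 1) (b := E)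
    rw [Finset.card_range] at h4
    rw [h4, ← Finset.prod_range_reflect (fun j : ℕ => ((j : ℤ) + 1) * E)]
    refine Finset.prod_congr rfl fun j hj => ?_
    have hj' : j < k := Finset.mem_range.1 hj
    rw [hrun k le_rfl]
    have e1 : ((k - 1 - (k - 1 - j) : ℕ) : ℤ) = j := by omega
    have e2 : ((k - 1 - j : ℕ) : ℤ) = k - 1 - j := by omega
    rw [e1, e2]
    ring
  rw [h3] at h2
  rwa [sub_sub]

/-- The orbit `r = a 0, a 1, …, a N = 0` of `r = N` under an integer polynomial, written as
`a i = N - ε * b i` with `ε = a 0 - a 1`, so that `b` starts with `0, 1`. Such `b` exist because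
`a 0 - a 1` divides all later differences of consecutive points. The sequence `b` need not itself be
an orbit of an integer polynomial; the last field is what `factorial_mul_pow_dvd_of_arith_run` says
about `a`. Only indices up to `N` are constrained to be distinct. -/
structure NormalizedOrbit (ε : ℤ) (N : ℕ) (b : ℕ → ℤ) : Prop where
  zero : b 0 = 0
  one : b 1 = 1
  dvd : ∀ i j, b i - b j ∣ b (i + 1) - b (j + 1)
  ne : ∀ i j, i < j → j ≤ N → b i ≠ b j
  last : ε * b N = N
  newton : ∀ (p k : ℕ) (E : ℤ), E ≠ 0 → (∀ i ≤ k + 1, b (p + i) = b p + i * E) →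
    ((k + 1).factorial : ℤ) * ε ^ k * E ^ (k + 1) ∣ b (p + k + 2) - b (p + k + 1) - E

/-! ### Growth of the steps of a normalized orbit -/

theorem one_add_mul_dvd {x q m : ℤ} (hx : x ≠ 0) (h : x + m * (x * q) ∣ (m + 1) * (x * q)) :
    1 + m * q ∣ m + 1 := by
  have h1 : 1 + m * q ∣ (m + 1) * q := by
    refine (mul_dvd_mul_iff_left hx).1 ?_
    rwa [show x * (1 + m * q) = x + m * (x * q) by ring,
      show x * ((m + 1) * q) = (m + 1) * (x * q) by ring]
  have h2 := (Dvd.intro_left (m + 1) rfl : 1 + m * q ∣ (m + 1) * (1 + m * q)).sub (h1.mul_left m)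
  rwa [show (m + 1) * (1 + m * q) - m * ((m + 1) * q) = m + 1 by ring] at h2

/-- The steps `x, y, y, y, y` with `y ≠ x` cannot occur: if `y = q * x`, then `1 + q ∣ 2`,
`1 + 2 * q ∣ 3` and `1 + 3 * q ∣ 4`. -/
theorem false_of_step_run {x y : ℤ} (hx : x ≠ 0) (hy : y ≠ 0) (hxy : y ≠ x) (h1 : x ∣ y)
    (h2 : x + y ∣ 2 * y) (h3 : x + 2 * y ∣ 3 * y) (h4 : x + 3 * y ∣ 4 * y) : False := by
  obtain ⟨q, rfl⟩ := h1
  have e2 : 1 + 1 * q ∣ 1 + 1 := one_add_mul_dvd hx (by simpa [one_add_one_eq_two] using h2)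
  have e3 : 1 + 2 * q ∣ 2 + 1 := one_add_mul_dvd hx h3
  have e4 : 1 + 3 * q ∣ 3 + 1 := one_add_mul_dvd hx h4
  have hq : q ≠ 0 := by rintro rfl; simp at hy
  have hq1 : q ≠ 1 := by rintro rfl; simp at hxy
  have hhi := Int.le_of_dvd (by norm_num) e2
  have hlo := Int.le_of_dvd (by norm_num) (neg_dvd.2 e2)
  have hlo : -3 ≤ q := by linarith
  have hhi : q ≤ 1 := by linarith
  clear h2 h3 h4 hxy hy
  interval_cases q <;> revert e2 e3 e4 hq hq1 <;> decide

namespace NormalizedOrbit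

variable {ε : ℤ} {N : ℕ} {b : ℕ → ℤ}

theorem step_ne_zero (hb : NormalizedOrbit ε N b) {i : ℕ} (hi : i + 1 ≤ N) :
    b (i + 1) - b i ≠ 0 :=
  sub_ne_zero.2 (hb.ne i (i + 1) (Nat.lt_succ_self i) hi).symm

theorem step_dvd_step (hb : NormalizedOrbit ε N b) (i t : ℕ) :
    b (i + 1) - b i ∣ b (i + t + 1) - b (i + t) := by
  induction t with
  | zero => simp
  | succ t ih => exact ih.trans (hb.dvd (i + t + 1) (i + t))

/-- Two consecutive steps are not opposite, as the orbit does not return to a previous point. -/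
theorem step_add_step_ne_zero (hb : NormalizedOrbit ε N b) {i : ℕ} (hi : i + 2 ≤ N) :
    b (i + 2) - b (i + 1) ≠ -(b (i + 1) - b i) := by
  have := hb.ne i (i + 2) (by omega) hi
  intro h
  apply this
  linarith

theorem not_four_equal_steps_of_ne (hb : NormalizedOrbit ε N b) {p : ℕ} (hpN : p + 5 ≤ N)
    (hp : b (p + 2) - b (p + 1) ≠ b (p + 1) - b p)
    (h1 : b (p + 3) - b (p + 2) = b (p + 2) - b (p + 1))
    (h2 : b (p + 4) - b (p + 3) = b (p + 2) - b (p + 1))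
    (h3 : b (p + 5) - b (p + 4) = b (p + 2) - b (p + 1)) : False := by
  have d1 := hb.dvd (p + 1) p
  have d2 := hb.dvd (p + 2) p
  have d3 := hb.dvd (p + 3) p
  have d4 := hb.dvd (p + 4) p
  simp only [add_assoc, Nat.reduceAdd] at d1 d2 d3 d4
  refine false_of_step_run (x := b (p + 1) - b p) (y := b (p + 2) - b (p + 1))
    (hb.step_ne_zero (by omega)) (hb.step_ne_zero (by omega)) hp d1 ?_ ?_ ?_
  · convert d2 using 1 <;> linarith
  · convert d3 using 1 <;> linarith
  · convert d4 using 1 <;> linarith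

/-- Once two consecutive steps differ, no four consecutive steps agree from there on. -/
theorem not_four_equal_steps (hb : NormalizedOrbit ε N b) {p : ℕ}
    (hp : b (p + 2) - b (p + 1) ≠ b (p + 1) - b p) (m : ℕ) (hpm : p + 1 ≤ m) (hm : m + 4 ≤ N)
    (h1 : b (m + 2) - b (m + 1) = b (m + 1) - b m)
    (h2 : b (m + 3) - b (m + 2) = b (m + 1) - b m)
    (h3 : b (m + 4) - b (m + 3) = b (m + 1) - b m) : False := by
  induction m, hpm using Nat.le_induction with
  | base => exact hb.not_four_equal_steps_of_ne (by omega) hp h1 h2 h3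
  | succ m hpm ih =>
    by_cases h0 : b (m + 2) - b (m + 1) = b (m + 1) - b m
    · exact ih (by omega) h0 (h1.trans h0) (h2.trans h0)
    · exact hb.not_four_equal_steps_of_ne (by omega) h0 h1 h2 h3

/-- Each step divides the next, so four steps without a doubling of the absolute value are equal up to
sign, hence equal. -/
theorem two_mul_abs_step_le (hb : NormalizedOrbit ε N b) {p : ℕ}
    (hp : b (p + 2) - b (p + 1) ≠ b (p + 1) - b p) (m : ℕ) (hpm : p + 1 ≤ m) (hm : m + 4 ≤ N) :
    2 * |b (m + 1) - b m| ≤ |b (m + 4) - b (m + 3)| := by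
  by_contra! hlt
  have key : ∀ t, t ≤ 3 → b (m + t + 1) - b (m + t) = b (m + 1) - b m ∨
      b (m + t + 1) - b (m + t) = -(b (m + 1) - b m) := by
    intro t ht
    have hx := hb.step_ne_zero (i := m) (by omega)
    have hy := hb.step_ne_zero (i := m + t) (by omega)
    have hz := hb.step_ne_zero (i := m + 3) (by omega)
    have h1 := hb.step_dvd_step m t
    have h2 := hb.step_dvd_step (m + t) (3 - t)
    rw [show m + t + (3 - t) = m + 3 by omega] at h2
    have h2' : |b (m + t + 1) - b (m + t)| ≤ |b (m + 4) - b (m + 3)| :=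
      Int.le_of_dvd (abs_pos.2 hz) ((abs_dvd_abs _ _).2 h2)
    obtain ⟨q, hq⟩ := h1
    rw [hq] at h2' hy ⊢
    have hxpos := abs_pos.2 hx
    rw [abs_mul] at h2'
    have hq2 : |q| < 2 := by
      by_contra! h
      nlinarith
    have hq0 : q ≠ 0 := right_ne_zero_of_mul hy
    rw [abs_lt] at hq2
    obtain rfl | rfl : q = 1 ∨ q = -1 := by omega
    · left; ring
    · right; ring
  have k1 := key 1 (by norm_num)
  have k2 := key 2 (by norm_num)
  have k3 := key 3 (by norm_num)
  have n1 := hb.step_add_step_ne_zero (i := m) (by omega)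
  have n2 := hb.step_add_step_ne_zero (i := m + 1) (by omega)
  have n3 := hb.step_add_step_ne_zero (i := m + 2) (by omega)
  have e1 := k1.resolve_right n1
  simp only [add_assoc, Nat.reduceAdd] at *
  have e2 := k2.resolve_right (by rw [← e1]; exact n2)
  have e3 := k3.resolve_right (by rw [← e2]; exact n3)
  exact hb.not_four_equal_steps hp m hpm hm e1 e2 e3

/-- Doubling every three indices outpaces linear growth. The slack of `4` in `hm` covers the first
two indices, at which nothing may have doubled yet. -/
theorem lt_abs_step (hb : NormalizedOrbit ε N b) {p m : ℕ} {c : ℤ}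
    (hp : b (p + 2) - b (p + 1) ≠ b (p + 1) - b p) (hpm : p + 1 ≤ m) (hc : 6 ≤ c)
    (hm : c + 4 < |b (m + 1) - b m|) (t : ℕ) (ht : m + t + 1 ≤ N) :
    c + 2 * t < |b (m + t + 1) - b (m + t)| := by
  induction t using Nat.strong_induction_on with
  | _ t ih =>
    rcases lt_or_ge t 3 with h3 | h3
    · have := Int.le_of_dvd (abs_pos.2 (hb.step_ne_zero ht))
        ((abs_dvd_abs _ _).2 (hb.step_dvd_step m t))
      omega
    · obtain ⟨s, rfl⟩ := Nat.exists_eq_add_of_le' h3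
      have h1 := ih s (by omega) (by omega)
      have h2 := hb.two_mul_abs_step_le hp (m + s) (by omega) (by omega)
      simp only [add_assoc, Nat.reduceAdd] at *
      push_cast
      linarith

theorem abs_last_le (hb : NormalizedOrbit ε N b) (hN : 0 < N) : |b N| ≤ N := by
  have h : b N ∣ (N : ℤ) := Dvd.intro_left ε hb.last
  have := Int.le_of_dvd (by exact_mod_cast hN) ((abs_dvd _ _).2 h)
  exact this

/-- The last step is bounded because `b N - b (N - 1)` is close to `b N`: the difference
`b (N - 1) - b 0` divides `b N - b 1`, which is not zero. -/
theorem abs_last_step_le (hb : NormalizedOrbit ε N b) {M : ℕ} (hM : N = M + 1) (hM0 : 0 < M) :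
    |b (M + 1) - b M| ≤ 2 * N + 1 := by
  have h1 := hb.abs_last_le (by omega)
  have h2 := hb.dvd M 0
  have h3 := hb.ne 1 (M + 1) (by omega) hM.ge
  rw [zero_add, hb.zero, hb.one, sub_zero] at h2
  rw [hb.one] at h3
  have h4 := Int.le_of_dvd (abs_pos.2 (sub_ne_zero.2 h3.symm)) ((abs_dvd_abs _ _).2 h2)
  subst hM
  rw [abs_le] at h1 h4 ⊢
  rcases abs_cases (b (M + 1) - 1) with h | h <;> constructor <;> omega

/-! ### Normalized orbits of length at least four -/

theorem abs_fifth_step (hb : NormalizedOrbit ε N b) (hN : 5 ≤ N)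
    (h : ¬ (b 2 = 2 ∧ b 3 = 3 ∧ b 4 = 4)) : 15 < |b 5 - b 4| := by
  by_contra! hle
  have hmem : ∀ i, i ≤ 4 → b (i + 1) - b i ∈ Finset.Icc (-15 : ℤ) 15 := by
    intro i hi
    have h1 := hb.step_dvd_step i (4 - i)
    rw [Nat.add_sub_cancel' hi] at h1
    have h2 := Int.le_of_dvd (abs_pos.2 (hb.step_ne_zero (i := 4) (by omega)))
      ((abs_dvd_abs _ _).2 h1)
    exact Finset.mem_Icc.2 (abs_le.1 (h2.trans hle))
  have d10 := hb.dvd 1 0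
  have d20 := hb.dvd 2 0
  have d30 := hb.dvd 3 0
  have d40 := hb.dvd 4 0
  have d21 := hb.dvd 2 1
  have d31 := hb.dvd 3 1
  have d41 := hb.dvd 4 1
  have d32 := hb.dvd 3 2
  have d42 := hb.dvd 4 2
  have d43 := hb.dvd 4 3
  have hne := fun i j (hij : i < j) (hj : j ≤ 5) => hb.ne i j hij (hj.trans hN)
  have n02 := hne 0 2 (by norm_num) (by norm_num)
  have n03 := hne 0 3 (by norm_num) (by norm_num)
  have n04 := hne 0 4 (by norm_num) (by norm_num)
  have n12 := hne 1 2 (by norm_num) (by norm_num)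
  have n13 := hne 1 3 (by norm_num) (by norm_num)
  have n14 := hne 1 4 (by norm_num) (by norm_num)
  have n23 := hne 2 3 (by norm_num) (by norm_num)
  have n24 := hne 2 4 (by norm_num) (by norm_num)
  have n34 := hne 3 4 (by norm_num) (by norm_num)
  have n45 := hne 4 5 (by norm_num) (by norm_num)
  have m1 := hmem 1 (by norm_num)
  have m2 := hmem 2 (by norm_num)
  have m3 := hmem 3 (by norm_num)
  have m4 := hmem 4 (by norm_num)
  have h0 := hb.zero
  have h1 := hb.one
  have h48 : b 2 = -1 → b 3 = -3 → b 4 = -5 → (48 : ℤ) ∣ b 5 - b 4 + 2 := by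
    intro e2 e3 e4
    have := hb.newton 1 2 (-2) (by norm_num) (by
      intro i hi
      interval_cases i <;> simp [h1, e2, e3, e4])
    refine (Dvd.intro (-ε ^ 2) ?_).trans this
    norm_num [Nat.factorial]
    ring
  simp only [Nat.reduceAdd] at *
  have tr : ∀ {p q p' q' : ℤ}, p ∣ q → p' = p → q' = q → p' ∣ q' := by
    rintro _ _ _ _ h rfl rfl
    exact h
  have := step_chain_of_abs_le_fifteen (b 2 - b 1) m1 (by omega) (by omega)
    (b 3 - b 2) m2 (by omega) d21 (by omega) (by omega) (tr d20 (by omega) (by omega))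
    (b 4 - b 3) m3 (by omega) d32 (by omega) (by omega) (by omega)
    (tr d31 (by omega) (by omega)) (tr d30 (by omega) (by omega))
    (b 5 - b 4) m4 (by omega) d43 (tr d42 (by omega) (by omega)) (tr d41 (by omega) (by omega))
    (tr d40 (by omega) (by omega))
    (fun e2 e3 e4 => h48 (by omega) (by omega) (by omega))
  exact h ⟨by omega, by omega, by omega⟩

/-- If `b` first leaves the progression `0, 1, 2, …` at the index `k + 2`, the step leading there is
too large for the bound `2 * N + 1` on the last step: for `k ≥ 3` because it is `1` modulo
`(k + 1)!`, and for `k < 3` the fifth step is by the search through short chains. -/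
theorem eq_id_of_five_le (hb : NormalizedOrbit ε N b) (hN : 5 ≤ N) :
    ∀ i ≤ N, b i = i := by
  by_contra! hne
  classical
  obtain ⟨hkN, hk⟩ := Nat.find_spec hne
  have hmin : ∀ j < Nat.find hne, b j = j := by
    intro j hj
    by_contra hj'
    exact Nat.find_min hne hj ⟨by omega, hj'⟩
  generalize Nat.find hne = n at *
  obtain ⟨k, rfl⟩ : ∃ k, n = k + 2 := by
    match n, hk with
    | 0, hk => simp [hb.zero] at hk
    | 1, hk => simp [hb.one] at hk
    | k + 2, _ => exact ⟨k, rfl⟩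
  have e0 : b k = k := hmin k (by omega)
  have e1 : b (k + 1) = k + 1 := by simpa using hmin (k + 1) (by omega)
  have hbreak : b (k + 2) - b (k + 1) ≠ b (k + 1) - b k := by
    intro h
    apply hk
    push_cast
    linarith
  obtain ⟨M, rfl⟩ : ∃ M, N = M + 1 := ⟨N - 1, by omega⟩
  have hlast := hb.abs_last_step_le rfl (by omega)
  rcases lt_or_ge k 3 with hk3 | hk3
  · have h5 := hb.abs_fifth_step hN (by
      rintro ⟨h2, h3, h4⟩
      apply hk
      interval_cases k <;> simpa)
    have := hb.lt_abs_step (m := 4) (c := 11) hbreak (by omega) (by norm_num) (by simpa using h5)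
      (M - 4) (by omega)
    rw [show 4 + (M - 4) = M by omega] at this
    push_cast at hlast
    omega
  · have hfac := hb.newton 0 k 1 one_ne_zero (by
      intro i hi
      rw [zero_add, hb.zero, hmin i (by omega)]
      ring)
    have hdvd : ((k + 1).factorial : ℤ) ∣ b (k + 2) - b (k + 1) - 1 := by
      rw [one_pow, mul_one, zero_add] at hfac
      exact (dvd_mul_right _ _).trans hfac
    have hne0 : b (k + 2) - b (k + 1) - 1 ≠ 0 := by
      intro h
      apply hk
      push_cast
      linarith
    have hle := Int.le_of_dvd (abs_pos.2 hne0) ((dvd_abs _ _).2 hdvd)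
    have hf : 6 * (k + 1) ≤ (k + 1).factorial := by
      rw [Nat.factorial_succ, mul_comm]
      exact Nat.mul_le_mul_left _ (Nat.factorial_le hk3)
    have hf' : 6 * ((k : ℤ) + 1) ≤ ((k + 1).factorial : ℤ) := by exact_mod_cast hf
    have habs := abs_sub (b (k + 2) - b (k + 1)) 1
    rw [abs_one] at habs
    have := hb.lt_abs_step (m := k + 1) (c := 2 * k + 5) hbreak le_rfl (by omega) (by
      simp only [add_assoc, Nat.reduceAdd]
      omega) (M - (k + 1)) (by omega)
    rw [show k + 1 + (M - (k + 1)) = M by omega] at this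
    push_cast at hlast
    omega

theorem four_cases (hb : NormalizedOrbit ε 4 b) :
    (ε = 1 ∧ ∀ i ≤ 4, b i = i) ∨ (ε = -1 ∧ b 2 = 2 ∧ b 3 = -1 ∧ b 4 = -4) := by
  have hmem : ∀ i, i ≤ 3 → b (i + 1) - b i ∈ Finset.Icc (-9 : ℤ) 9 := by
    intro i hi
    have h1 := hb.step_dvd_step i (3 - i)
    rw [Nat.add_sub_cancel' hi] at h1
    have h2 := Int.le_of_dvd (abs_pos.2 (hb.step_ne_zero (i := 3) (by omega)))
      ((abs_dvd_abs _ _).2 h1)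
    exact Finset.mem_Icc.2 (abs_le.1 (h2.trans (hb.abs_last_step_le rfl (by norm_num))))
  have d20 := hb.dvd 2 0
  have d30 := hb.dvd 3 0
  have d21 := hb.dvd 2 1
  have d31 := hb.dvd 3 1
  have d32 := hb.dvd 3 2
  have n02 := hb.ne 0 2 (by norm_num) (by norm_num)
  have n03 := hb.ne 0 3 (by norm_num) (by norm_num)
  have n12 := hb.ne 1 2 (by norm_num) (by norm_num)
  have n13 := hb.ne 1 3 (by norm_num) (by norm_num)
  have n14 := hb.ne 1 4 (by norm_num) (by norm_num)
  have n23 := hb.ne 2 3 (by norm_num) (by norm_num)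
  have n24 := hb.ne 2 4 (by norm_num) (by norm_num)
  have n34 := hb.ne 3 4 (by norm_num) (by norm_num)
  have m1 := hmem 1 (by norm_num)
  have m2 := hmem 2 (by norm_num)
  have m3 := hmem 3 (by norm_num)
  have h0 := hb.zero
  have h1 := hb.one
  have hl := hb.last
  have h24 : b 2 = 2 → b 3 = 3 → (6 * ε ^ 2 : ℤ) ∣ b 4 - b 3 - 1 := by
    intro e2 e3
    have := hb.newton 0 2 1 one_ne_zero (by
      intro i hi
      interval_cases i <;> simp [h0, h1, e2, e3])
    simpa [Nat.factorial] using this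
  simp only [Nat.reduceAdd] at *
  have tr : ∀ {p q p' q' : ℤ}, p ∣ q → p' = p → q' = q → p' ∣ q' := by
    rintro _ _ _ _ h rfl rfl
    exact h
  have := step_chain_of_abs_le_nine (b 2 - b 1) m1 (by omega) (by omega)
    (b 3 - b 2) m2 (by omega) d21 (by omega) (by omega) (tr d20 (by omega) (by omega))
    (b 4 - b 3) m3 (by omega) d32 (by omega) (by omega)
    (tr d31 (by omega) (by omega)) (tr d30 (by omega) (by omega)) (by omega)
    (tr (Dvd.intro_left ε hl) (by omega) rfl)
  rcases this with ⟨e1, e2, e3⟩ | ⟨e1, e2, e3⟩ | ⟨e1, e2, e3⟩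
  · have h4 : b 4 = 4 := by omega
    refine .inl ⟨by rw [h4] at hl; push_cast at hl; omega, fun i hi => ?_⟩
    interval_cases i <;> push_cast <;> omega
  · have h4 : b 4 = -4 := by omega
    exact .inr ⟨by rw [h4] at hl; push_cast at hl; omega, by omega, by omega, h4⟩
  -- Here `ε = -2`, and the third difference `-6` would have to be divisible by `6 * ε ^ 2`.
  · have h4 : b 4 = -2 := by omega
    obtain rfl : ε = -2 := by rw [h4] at hl; push_cast at hl; omega
    have := h24 (by omega) (by omega)
    rw [e3] at this
    norm_num at this

end NormalizedOrbit

/-! ### From polynomials to normalized orbits and back -/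

theorem exists_normalizedOrbit (u : ℤ[X]) (N : ℕ) (hN : 0 < N)
    (hu : IsNilpotentAtOfIndex u N N) :
    ∃ (ε : ℤ) (b : ℕ → ℤ), NormalizedOrbit ε N b ∧
      ∀ i, u.eval (N - ε * b i) = N - ε * b (i + 1) := by
  obtain ⟨a, ha0, hsucc, haN, hne⟩ : ∃ a : ℕ → ℤ, a 0 = N ∧ (∀ i, a (i + 1) = u.eval (a i)) ∧
      a N = 0 ∧ ∀ i < N, a i ≠ 0 := by
    have hiter : ∀ n, (polyIter u n).eval (N : ℤ) = (fun x => u.eval x)^[n] N := by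
      intro n
      rw [polyIter, iterate_comp_eval, eval_X]
    refine ⟨fun n => (fun x => u.eval x)^[n] N, rfl,
      fun i => Function.iterate_succ_apply' _ _ _, ?_, fun i hi h => ?_⟩
    · exact (hiter N).symm.trans hu.1.2
    · rcases Nat.eq_zero_or_pos i with rfl | hi0
      · simp at h
        omega
      · exact absurd (hu.2 ⟨hi0, (hiter i).trans h⟩) (not_le.2 hi)
  have hadvd : ∀ i j, a i - a j ∣ a (i + 1) - a (j + 1) := by
    intro i j
    rw [hsucc, hsucc]
    exact sub_dvd_eval_sub _ _ _
  have hainj : ∀ i j, i < j → j ≤ N → a i ≠ a j := by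
    intro i j hij hjN h
    -- A repeated point makes the orbit reach `0` before time `N`.
    have hshift : ∀ t, a (i + t) = a (j + t) := by
      intro t
      induction t with
      | zero => exact h
      | succ t ih => rw [← add_assoc, ← add_assoc, hsucc, hsucc, ih]
    have := hshift (N - j)
    rw [Nat.add_sub_cancel' hjN, haN] at this
    exact hne _ (by omega) this
  have hstep : ∀ i, a 0 - a 1 ∣ a i - a (i + 1) := by
    intro i
    induction i with
    | zero => exact dvd_rfl
    | succ i ih => exact ih.trans (hadvd i (i + 1))
  have hall : ∀ i, a 0 - a 1 ∣ a 0 - a i := by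
    intro i
    induction i with
    | zero => simp
    | succ i ih => simpa using ih.add (hstep i)
  choose b hb using hall
  generalize hε : a 0 - a 1 = ε at hb
  have hε0 : ε ≠ 0 := hε ▸ sub_ne_zero.2 (hainj 0 1 one_pos hN)
  have hab : ∀ i, a i = N - ε * b i := fun i => by rw [← hb i, ha0]; ring
  refine ⟨ε, b, ⟨?_, ?_, fun i j => ?_, fun i j hij hj h => ?_, ?_, fun p k E hE hrun => ?_⟩,
    fun i => by rw [← hab, ← hab, hsucc]⟩
  · simpa [hε0] using (hb 0).symm
  · have := hb 1
    rw [hε] at this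
    exact (mul_right_eq_self₀.1 this.symm).resolve_right hε0
  · refine (mul_dvd_mul_iff_left hε0).1 ?_
    have := neg_dvd.2 (dvd_neg.2 (hadvd i j))
    rw [hab, hab, hab, hab] at this
    rwa [show ε * (b i - b j) = -((N - ε * b i) - (N - ε * b j)) by ring,
      show ε * (b (i + 1) - b (j + 1)) = -((N - ε * b (i + 1)) - (N - ε * b (j + 1))) by ring]
  · exact hainj i j hij hj (by rw [hab, hab, h])
  · have := hab N
    rw [haN] at this
    linarith
  · have := factorial_mul_pow_dvd_of_arith_run u a hsucc p (k + 1) (-ε * E)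
      (mul_ne_zero (neg_ne_zero.2 hε0) hE) (fun i hi => by
        rw [hab, hab, hrun i hi]
        ring)
    rw [hab, hab] at this
    refine (mul_dvd_mul_iff_left hε0).1 ?_
    refine ((Dvd.intro ((-1) ^ (k + 1)) ?_).trans this).trans (Dvd.intro (-1) ?_)
    · rw [neg_mul, neg_pow (ε * E), mul_pow]
      ring
    · rw [← add_assoc]
      ring

theorem eq_X_sub_one_add_prod_mul (u : ℤ[X]) (N : ℕ) (h : ∀ i < N, u.eval ((N : ℤ) - i) = N - (i + 1)) :
    ∃ p : ℤ[X], u = (X - 1) + (∏ i ∈ Finset.Icc (1 : ℤ) N, (X - C i)) * p := by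
  obtain ⟨p, hp⟩ := prod_X_sub_C_dvd_of_eval_eq_zero (u - (X - 1)) (Finset.Icc (1 : ℤ) N)
    (fun x hx => by
      rw [Finset.mem_Icc] at hx
      have := h (N - x).toNat (by omega)
      rw [Int.toNat_of_nonneg (by omega), sub_sub_cancel] at this
      simp only [eval_sub, eval_X, eval_one, this]
      ring)
  exact ⟨p, by rw [← hp]; ring⟩

theorem eq_of_isNilpotentAtOfIndex_natCast (N : ℕ) (hN : 3 < N) (u : ℤ[X]) (hu : IsNilpotentAtOfIndex u N N) :
    (∃ p : ℤ[X], u = (X - 1) + (∏ i ∈ Finset.Icc (1 : ℤ) N, (X - C i)) * p) ∨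
    (N = 4 ∧ ∃ p : ℤ[X], u = (-2 * X ^ 2 + 19 * X - 39) +
      p * ((X - 3) * (X - 4) * (X - 5) * (X - 6))) := by
  obtain ⟨ε, b, hb, hval⟩ := exists_normalizedOrbit u N (by omega) hu
  have hlin : ε = 1 → (∀ i ≤ N, b i = i) →
      ∃ p : ℤ[X], u = (X - 1) + (∏ i ∈ Finset.Icc (1 : ℤ) N, (X - C i)) * p := by
    rintro rfl hid
    refine eq_X_sub_one_add_prod_mul u N fun i hi => ?_
    simpa [hid i hi.le, hid (i + 1) hi] using hval i
  rcases eq_or_lt_of_le (Nat.succ_le_of_lt hN) with rfl | h5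
  · rcases hb.four_cases with ⟨hε, hid⟩ | ⟨rfl, h2, h3, h4⟩
    · exact .inl (hlin hε hid)
    · refine .inr ⟨rfl, ?_⟩
      have v0 := hval 0
      have v1 := hval 1
      have v2 := hval 2
      have v3 := hval 3
      norm_num [hb.zero, hb.one, h2, h3, h4] at v0 v1 v2 v3
      obtain ⟨p, hp⟩ := prod_X_sub_C_dvd_of_eval_eq_zero (u - (-2 * X ^ 2 + 19 * X - 39))
        {3, 4, 5, 6} (fun x hx => by
          simp only [Finset.mem_insert, Finset.mem_singleton] at hx
          rcases hx with rfl | rfl | rfl | rfl <;> simp [v0, v1, v2, v3])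
      refine ⟨p, ?_⟩
      rw [sub_eq_iff_eq_add'] at hp
      rw [hp]
      simp
      ring
  · have hid := hb.eq_id_of_five_le h5
    have hl := hb.last
    rw [hid N le_rfl] at hl
    exact .inl (hlin ((mul_eq_right₀ (by positivity)).1 hl) hid)

/-- Conjugation by `x ↦ -x` exchanges the cases of positive and negative `r`. -/
theorem isNilpotentAtOfIndex_neg_comp_neg {u : ℤ[X]} {r : ℤ} {m : ℕ} (hu : IsNilpotentAtOfIndex u r m) :
    IsNilpotentAtOfIndex (-(u.comp (-X))) (-r) m := by
  have h : ∀ n, (polyIter (-(u.comp (-X))) n).eval (-r) = -(polyIter u n).eval r := by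
    intro n
    rw [polyIter, polyIter, iterate_comp_eval, iterate_comp_eval, eval_X, eval_X]
    induction n with
    | zero => rfl
    | succ n ih => rw [Function.iterate_succ_apply', ih, Function.iterate_succ_apply']; simp
  simpa only [IsNilpotentAtOfIndex, h, neg_eq_zero] using hu

theorem eq_neg_comp_neg {u v : ℤ[X]} (h : -(u.comp (-X)) = v) : u = -(v.comp (-X)) := by
  rw [← h]
  simp [comp_assoc]

theorem theorem1p6 :
    (∀ (r : ℤ) (u : ℤ[X]), 3 < r → IsNilpotentAtOfIndex u r r.natAbs →
      (r = 4 ∧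
        ((∃ p : ℤ[X], u = (X - 1) + (∏ i ∈ Finset.Icc (1 : ℤ) r, (X - C i)) * p) ∨
         (∃ p : ℤ[X], u = (-2 * X ^ 2 + 19 * X - 39) +
            p * ((X - 3) * (X - 4) * (X - 5) * (X - 6))))) ∨
      (5 ≤ r ∧
        ∃ p : ℤ[X], u = (X - 1) + (∏ i ∈ Finset.Icc (1 : ℤ) r, (X - C i)) * p)) ∧
    (∀ (r : ℤ) (u : ℤ[X]), r < -3 → IsNilpotentAtOfIndex u r r.natAbs →
      (r = -4 ∧
        ((∃ p : ℤ[X], u = (X + 1) + (∏ i ∈ Finset.Icc (1 : ℤ) |r|, (X + C i)) * p) ∨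
         (∃ p : ℤ[X], u = (2 * X ^ 2 + 19 * X + 39) +
            p * ((X + 3) * (X + 4) * (X + 5) * (X + 6))))) ∨
      (5 ≤ |r| ∧
        ∃ p : ℤ[X], u = (X + 1) + (∏ i ∈ Finset.Icc (1 : ℤ) |r|, (X + C i)) * p)) := by
  refine ⟨fun r u hr hu => ?_, fun r u hr hu => ?_⟩
  · obtain ⟨N, rfl⟩ := Int.eq_ofNat_of_zero_le (show 0 ≤ r by omega)
    rw [Int.natAbs_natCast] at hu
    rcases eq_of_isNilpotentAtOfIndex_natCast N (by omega) u hu with h | ⟨rfl, h⟩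
    · rcases (show (N : ℤ) = 4 ∨ 5 ≤ (N : ℤ) by omega) with h4 | h5
      · exact .inl ⟨h4, .inl h⟩
      · exact .inr ⟨h5, h⟩
    · exact .inl ⟨rfl, .inr h⟩
  · obtain ⟨N, hN⟩ := Int.eq_ofNat_of_zero_le (show 0 ≤ -r by omega)
    obtain rfl : r = -N := by omega
    have hu' := isNilpotentAtOfIndex_neg_comp_neg hu
    rw [Int.natAbs_neg, Int.natAbs_natCast, neg_neg] at hu'
    rw [abs_neg, Nat.abs_cast]
    rcases eq_of_isNilpotentAtOfIndex_natCast N (by omega) _ hu' with ⟨p, hp⟩ | ⟨rfl, p, hp⟩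
    · have h : ∃ q : ℤ[X], u = (X + 1) + (∏ i ∈ Finset.Icc (1 : ℤ) N, (X + C i)) * q := by
        refine ⟨-((-1) ^ N * p.comp (-X)), ?_⟩
        rw [eq_neg_comp_neg hp]
        have hprod : (∏ i ∈ Finset.Icc (1 : ℤ) N, (X - C i)).comp (-X) =
            (-1) ^ N * ∏ i ∈ Finset.Icc (1 : ℤ) N, (X + C i) := by
          rw [Polynomial.prod_comp, Finset.prod_congr rfl (fun i _ =>
              show (X - C i).comp (-X) = -1 * (X + C i) by simp; ring),
            Finset.prod_mul_distrib, Finset.prod_const, Int.card_Icc]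
          simp
        rw [add_comp, mul_comp, hprod]
        simp
        ring
      rcases (show (N : ℤ) = 4 ∨ 5 ≤ (N : ℤ) by omega) with h4 | h5
      · exact .inl ⟨by omega, .inl h⟩
      · exact .inr ⟨h5, h⟩
    · refine .inl ⟨by norm_num, .inr ⟨-p.comp (-X), ?_⟩⟩
      rw [eq_neg_comp_neg hp]
      simp
      ring
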